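/- Call an integral domain an SP-domain if each of its ideals is a finite product of radical ideals. Call an integral domain $A$ an ISP-domain if every proper nonzero ideal $I$ of $A$ can be written as $I=JQ_1\cdots Q_n$, where $n\ge 1$, $J$ is an invertible ideal and each $Q_i$ is a proper radical ideal. Call a domain $A$ h-local if $A/P$ is local for every nonzero prime ideal $P$ of $A$ and $A/I$ has only finitely many maximal ideals for every nonzero ideal $I$ of $A$. Proposition 4.1. Let $C$ be an SP-domain that is not a Dedekind domain (fields being counted as Dedekind domains), let $M=qC$ be a principal maximal ideal of $C$, let $\pi\colon C\to C/M$ be the canonical map, and let $D\subseteq C/M$ be a discrete valuation ring with quotient field $C/M$. Assume that there exists a unit $p$ of $C$ such that $\pi(p)$ lies in $D$ and generates the maximal ideal of $D$. Then the pullback domain $A=\pi^{-1}(D)$ is an ISP-domain of Krull dimension two which is not h-local. -/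

import Mathlib

open scoped nonZeroDivisors

/-- An SP-domain: an integral domain in which every ideal is a (finite) product of radical
ideals. -/
structure IsSPDomain (R : Type*) [CommRing R] : Prop where
  isDomain : IsDomain R
  exists_prod_radical : ∀ I : Ideal R,
    ∃ Q : List (Ideal R), (∀ J ∈ Q, J.IsRadical) ∧ I = Q.prod

/-- An integral ideal is invertible if it is a unit of the monoid of fractional ideals. -/
def IsInvertibleIdeal {R : Type*} [CommRing R] (J : Ideal R) : Prop :=
  IsUnit (J : FractionalIdeal R⁰ (FractionRing R))

/-- An ISP-domain: an integral domain in which every proper nonzero ideal is of the form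
`J * Q₁ * ⋯ * Qₙ` with `n ≥ 1`, `J` invertible and every `Qᵢ` a proper radical ideal. -/
structure IsISPDomain (R : Type*) [CommRing R] : Prop where
  isDomain : IsDomain R
  exists_factorization : ∀ I : Ideal R, I ≠ ⊤ → I ≠ ⊥ →
    ∃ (J : Ideal R) (Q : List (Ideal R)), IsInvertibleIdeal J ∧ Q ≠ [] ∧
      (∀ H ∈ Q, H ≠ ⊤ ∧ H.IsRadical) ∧ I = J * Q.prod

/-- The condition of h-locality (used for domains): `R ⧸ P` is local for each nonzero prime
ideal `P`, and `R ⧸ I` is semilocal (has finitely many maximal ideals) for each nonzero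
ideal `I`. -/
structure IsHLocal (R : Type*) [CommRing R] : Prop where
  isLocalRing_quotient : ∀ P : Ideal R, P.IsPrime → P ≠ ⊥ → IsLocalRing (R ⧸ P)
  finite_maximalSpectrum_quotient : ∀ I : Ideal R, I ≠ ⊥ → Finite (MaximalSpectrum (R ⧸ I))

/-! ### Products of ideals and divisors of principal ideals. -/

section IdealLemmas

variable {R : Type*} [CommRing R]

/-! Since `p` is a unit of `C` lying over a uniformizer of `D`, inverting `p` in `A` gives `C`;
moreover `pA` is a maximal ideal of `A`, and `M = qC` lies in `A` and contains every element of `A`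
divisible by all powers of `p`. The structure `IsPrincipalPullback` records this, and the rest uses
nothing else about `A`.

An ideal of `A` outside `pA` is contracted from `C`, so its radical factorization over `C` contracts
to one over `A`. An ideal inside `pA` is first divided by the largest possible `p^n` or, when it
lies in every `p^n A`, by the largest possible `q^(j+1) p^m` with `m` an integer. If no `m` is
possible, the ideal is stable under division by `p`, and its factorization is read off in `C`.

Two facts about SP-domains are needed: nonzero primes are maximal, and powers of a prime element
intersect in zero. The first bounds chains of primes in `A`, where `0 < M < pA` has length two; the
second makes `j` exist. Finally, if `A` were h-local, each nonzero element of `C` would lie in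
finitely many maximal ideals, and an SP-domain with that property is Dedekind. -/

theorem Ideal.IsPrime.exists_mem_le_of_list_prod_le {P : Ideal R} (hP : P.IsPrime)
    {L : List (Ideal R)} (h : L.prod ≤ P) : ∃ Q ∈ L, Q ≤ P := by
  have := (hP.multiset_prod_le (s := (L : Multiset (Ideal R)))).1 (by simpa using h)
  simpa using this

theorem Ideal.list_prod_le_of_mem {L : List (Ideal R)} {Q : Ideal R} (h : Q ∈ L) : L.prod ≤ Q :=
  Ideal.le_of_dvd (List.dvd_prod h)

/-- Improper factors can be dropped from a product of radical ideals. -/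
theorem Ideal.exists_list_proper_prod_eq (L : List (Ideal R)) :
    ∃ L' : List (Ideal R), (∀ Q ∈ L', Q ∈ L ∧ Q ≠ ⊤) ∧ L'.prod = L.prod := by
  induction L with
  | nil => exact ⟨[], by simp, rfl⟩
  | cons Q L ih =>
    obtain ⟨L', h, e⟩ := ih
    by_cases hQ : Q = ⊤
    · exact ⟨L', fun H hH => ⟨List.mem_cons_of_mem _ (h H hH).1, (h H hH).2⟩, by
        rw [List.prod_cons, e, hQ, Ideal.top_mul]⟩
    · refine ⟨Q :: L', fun H hH => ?_, by rw [List.prod_cons, List.prod_cons, e]⟩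
      rcases List.mem_cons.1 hH with rfl | hH
      · exact ⟨List.mem_cons_self, hQ⟩
      · exact ⟨List.mem_cons_of_mem _ (h H hH).1, (h H hH).2⟩

/-- Over a local domain, a factor of a nonzero principal ideal is principal. -/
theorem Ideal.exists_eq_span_singleton_of_mul_eq [IsDomain R] [IsLocalRing R] {Q Q' : Ideal R}
    {x : R} (hx : x ≠ 0) (h : Q * Q' = Ideal.span {x}) : ∃ a, Q = Ideal.span {a} := by
  by_contra! hcon
  -- If some product `a * b` were a unit times `x`, then `a` would generate `Q`; otherwise every
  -- product has a nonunit cofactor.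
  have key : Q * Q' ≤ IsLocalRing.maximalIdeal R * Ideal.span {x} := by
    rw [Ideal.mul_le]
    intro a ha b hb
    have hab : a * b ∈ Ideal.span {x} := h ▸ Ideal.mul_mem_mul ha hb
    obtain ⟨u, hu⟩ := Ideal.mem_span_singleton'.1 hab
    by_cases hu' : IsUnit u
    · exfalso
      refine hcon a (le_antisymm (fun c hc => ?_) ((Ideal.span_singleton_le_iff_mem _).2 ha))
      have hcb : c * b ∈ Ideal.span {x} := h ▸ Ideal.mul_mem_mul hc hb
      obtain ⟨v, hv⟩ := Ideal.mem_span_singleton'.1 hcb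
      have hb0 : b ≠ 0 := by
        rintro rfl
        rw [mul_zero] at hu
        exact (mul_ne_zero hu'.ne_zero hx) hu
      obtain ⟨w, rfl⟩ := hu'
      refine Ideal.mem_span_singleton'.2 ⟨v * ↑w⁻¹, mul_right_cancel₀ hb0 ?_⟩
      have : x = ↑w⁻¹ * (a * b) := by rw [← hu, ← mul_assoc, Units.inv_mul, one_mul]
      rw [← hv, this]
      ring
    · rw [← hu]
      exact Ideal.mul_mem_mul ((IsLocalRing.mem_maximalIdeal _).2 hu')
        (Ideal.mem_span_singleton_self x)
  have hx' : x ∈ IsLocalRing.maximalIdeal R * Ideal.span {x} :=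
    key (h ▸ Ideal.mem_span_singleton_self x)
  obtain ⟨z, hz, hzx⟩ := Ideal.mem_mul_span_singleton.1 hx'
  have : z = 1 := mul_right_cancel₀ hx (by rw [hzx, one_mul])
  exact (IsLocalRing.mem_maximalIdeal _).1 hz (this ▸ isUnit_one)

/-- Only finitely many elements of `N` occur in an expression of `y`. Finite generation is what
later allows Nakayama after localizing at a minimal prime of `I`. -/
theorem Ideal.exists_fg_le_mem_mul_self {N : Ideal R} {y : R} (h : y ∈ N * N) :
    ∃ I : Ideal R, I.FG ∧ I ≤ N ∧ y ∈ I * I := by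
  induction h using Submodule.mul_induction_on' with
  | mem_mul_mem a ha b hb =>
    refine ⟨Ideal.span {a, b}, Submodule.fg_span (Set.toFinite _), ?_, ?_⟩
    · rw [Ideal.span_le]
      rintro z (rfl | rfl)
      · exact ha
      · exact hb
    · exact Ideal.mul_mem_mul (Ideal.subset_span (by simp)) (Ideal.subset_span (by simp))
  | add a _ b _ iha ihb =>
    obtain ⟨I, hI, hIN, haI⟩ := iha
    obtain ⟨J, hJ, hJN, hbJ⟩ := ihb
    exact ⟨I ⊔ J, Submodule.FG.sup hI hJ, sup_le hIN hJN, Ideal.add_mem _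
      (Ideal.mul_mono le_sup_left le_sup_left haI)
      (Ideal.mul_mono le_sup_right le_sup_right hbJ)⟩

end IdealLemmas

/-! ### Invertible ideals. -/

namespace IsInvertibleIdeal

variable {R : Type*} [CommRing R] {I J : Ideal R}

theorem mul (hI : IsInvertibleIdeal I) (hJ : IsInvertibleIdeal J) :
    IsInvertibleIdeal (I * J) := by
  unfold IsInvertibleIdeal
  rw [FractionalIdeal.coeIdeal_mul]
  exact IsUnit.mul hI hJ

theorem of_dvd (hJ : IsInvertibleIdeal J) (h : I ∣ J) : IsInvertibleIdeal I := by
  obtain ⟨X, rfl⟩ := h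
  unfold IsInvertibleIdeal at hJ
  rw [FractionalIdeal.coeIdeal_mul] at hJ
  exact isUnit_of_mul_isUnit_left hJ

theorem list_prod {L : List (Ideal R)} (hL : ∀ Q ∈ L, IsInvertibleIdeal Q) :
    IsInvertibleIdeal L.prod := by
  induction L with
  | nil => simp [IsInvertibleIdeal]
  | cons Q L ih =>
    rw [List.prod_cons]
    exact (hL Q List.mem_cons_self).mul (ih fun H hH => hL H (List.mem_cons_of_mem _ hH))

theorem span_singleton [IsDomain R] {x : R} (hx : x ≠ 0) : IsInvertibleIdeal (Ideal.span {x}) := by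
  unfold IsInvertibleIdeal
  rw [FractionalIdeal.coeIdeal_span_singleton]
  exact IsUnit.of_mul_eq_one _ (FractionalIdeal.spanSingleton_mul_inv (FractionRing R)
    (by simpa using hx))

end IsInvertibleIdeal

theorem isDedekindDomain_of_isInvertibleIdeal {R : Type*} [CommRing R] [IsDomain R]
    (h : ∀ I : Ideal R, I ≠ ⊥ → IsInvertibleIdeal I) : IsDedekindDomain R := by
  rw [isDedekindDomain_iff_mul_inv_cancel (K := FractionRing R)]
  intro I hI
  obtain ⟨a, J, ha, rfl⟩ := FractionalIdeal.exists_eq_spanSingleton_mul I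
  have hJ : J ≠ ⊥ := by
    rintro rfl
    simp at hI
  have ha' : algebraMap R (FractionRing R) a ≠ 0 := by simpa using ha
  have hu : IsUnit (FractionalIdeal.spanSingleton R⁰ (algebraMap R (FractionRing R) a)⁻¹) :=
    IsUnit.of_mul_eq_one _ (FractionalIdeal.spanSingleton_mul_inv _ (inv_ne_zero ha'))
  exact (FractionalIdeal.mul_inv_cancel_iff_isUnit _).2 (hu.mul (h J hJ))

/-! ### SP-domains: dimension, powers of primes, a Dedekind criterion. -/

namespace IsSPDomain

variable {R : Type*} [CommRing R]

theorem exists_list (h : IsSPDomain R) (I : Ideal R) :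
    ∃ L : List (Ideal R), (∀ Q ∈ L, Q.IsRadical ∧ Q ≠ ⊤) ∧ L.prod = I := by
  obtain ⟨L, hL, rfl⟩ := h.exists_prod_radical I
  obtain ⟨L', hL', e⟩ := Ideal.exists_list_proper_prod_eq L
  exact ⟨L', fun Q hQ => ⟨hL Q (hL' Q hQ).1, (hL' Q hQ).2⟩, e⟩

theorem localization (h : IsSPDomain R) (P : Ideal R) [P.IsPrime] :
    IsSPDomain (Localization.AtPrime P) := by
  have := h.isDomain
  refine ⟨inferInstance, fun I => ?_⟩
  obtain ⟨L, hL, hI⟩ := h.exists_prod_radical (I.comap (algebraMap R (Localization.AtPrime P)))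
  refine ⟨L.map (Ideal.map (algebraMap R (Localization.AtPrime P))), fun J hJ => ?_, ?_⟩
  · obtain ⟨Q, hQ, rfl⟩ := List.mem_map.1 hJ
    rw [← (hL Q hQ).radical, IsLocalization.map_radical P.primeCompl]
    exact Ideal.radical_isRadical _
  · have := map_list_prod (Ideal.mapHom (algebraMap R (Localization.AtPrime P))) L
    rw [← hI] at this
    exact (IsLocalization.map_under P.primeCompl (Localization.AtPrime P) I).symm.trans this

/-- A nonzero element of a prime ideal lies in a radical factor of the ideal it generates. -/
theorem exists_factor_le (h : IsSPDomain R) {P : Ideal R} (hP : P.IsPrime) {x : R}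
    (hx : x ∈ P) : ∃ Q Q' : Ideal R, Q.IsRadical ∧ Q ≤ P ∧ Q * Q' = Ideal.span {x} := by
  obtain ⟨L, hL, hLx⟩ := h.exists_list (Ideal.span {x})
  obtain ⟨Q, hQ, hQP⟩ := hP.exists_mem_le_of_list_prod_le
    (hLx.trans_le ((Ideal.span_singleton_le_iff_mem _).2 hx))
  obtain ⟨Q', hQ'⟩ := List.dvd_prod hQ
  exact ⟨Q, Q', (hL Q hQ).1, hQP, by rw [← hQ', hLx]⟩

section Local

variable [IsLocalRing R]

theorem exists_radical_dvd (h : IsSPDomain R) {P : Ideal R} (hP : P.IsPrime) {x : R}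
    (hx : x ∈ P) (hx0 : x ≠ 0) :
    ∃ y, y ∈ P ∧ y ≠ 0 ∧ (Ideal.span {y}).IsRadical ∧ y ∣ x := by
  have := h.isDomain
  obtain ⟨Q, Q', hQ, hQP, e⟩ := h.exists_factor_le hP hx
  obtain ⟨y, rfl⟩ := Ideal.exists_eq_span_singleton_of_mul_eq hx0 e
  have hyx : y ∣ x := Ideal.span_singleton_le_span_singleton.1 (e.ge.trans Ideal.mul_le_left)
  exact ⟨y, hQP (Ideal.mem_span_singleton_self y), fun h0 => hx0 (zero_dvd_iff.1 (h0 ▸ hyx)),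
    hQ, hyx⟩

open IsLocalRing

/-- Factor `(y, z^2)` into proper radical ideals. With two or more factors it lies in the square of
the maximal ideal. A single factor would contain `z`, so `z = a y + b z^2`, and `1 - b z` being a
unit would force `z ∈ (y)`. -/
theorem mem_maximalIdeal_mul_self (h : IsSPDomain R) {y z : R} (hy : y ∈ maximalIdeal R)
    (hz : z ∈ maximalIdeal R) (hzy : z ∉ Ideal.span {y}) :
    y ∈ maximalIdeal R * maximalIdeal R := by
  obtain ⟨L, hL, hLI⟩ := h.exists_list (Ideal.span {y, z ^ 2})
  have hyI : y ∈ Ideal.span {y, z ^ 2} := Ideal.subset_span (by simp)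
  match L, hL, hLI with
  | [], _, hLI =>
    rw [List.prod_nil, Ideal.one_eq_top] at hLI
    have : Ideal.span {y, z ^ 2} ≤ maximalIdeal R := by
      rw [Ideal.span_le]
      rintro w (rfl | rfl)
      · exact hy
      · exact Ideal.pow_mem_of_mem _ hz 2 two_pos
    exact absurd (top_le_iff.1 (hLI.trans_le this)) (maximalIdeal.isMaximal R).ne_top
  | [Q], hL, hLI =>
    rw [List.prod_singleton] at hLI
    have hzQ : z ∈ Q := (hL Q (by simp)).1 ⟨2, hLI ▸ Ideal.subset_span (by simp)⟩
    rw [hLI] at hzQ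
    obtain ⟨a, b, hab⟩ := Ideal.mem_span_pair.1 hzQ
    have hu : IsUnit (1 - b * z) :=
      isUnit_one_sub_self_of_mem_nonunits _ (Ideal.mul_mem_left _ b hz)
    refine absurd ?_ hzy
    rw [← Ideal.mul_unit_mem_iff_mem _ hu]
    exact Ideal.mem_span_singleton'.2 ⟨a, by linear_combination hab⟩
  | Q :: Q' :: L, hL, hLI =>
    have hle : (Q :: Q' :: L).prod ≤ maximalIdeal R * maximalIdeal R := by
      rw [List.prod_cons, List.prod_cons, ← mul_assoc]
      exact Ideal.mul_le_left.trans (Ideal.mul_mono (le_maximalIdeal (hL Q (by simp)).2)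
        (le_maximalIdeal (hL Q' (by simp)).2))
    exact hle (hLI ▸ hyI)

/-- If the maximal ideal of a local SP-domain is the radical of a finitely generated ideal, then
it is principal. -/
theorem exists_maximalIdeal_eq_span (h : IsSPDomain R) {I : Ideal R} (hI : I.FG)
    (hrad : I.radical = maximalIdeal R) : ∃ w, maximalIdeal R = Ideal.span {w} := by
  have := h.isDomain
  by_contra! hcon
  -- A nonprincipal maximal ideal is idempotent; then `I`, a product of copies of it, equals it, and
  -- Nakayama makes it zero.
  have hidem : maximalIdeal R * maximalIdeal R = maximalIdeal R := by
    refine le_antisymm Ideal.mul_le_right fun x hx => ?_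
    by_cases hx0 : x = 0
    · exact hx0 ▸ zero_mem _
    obtain ⟨y, hy, -, -, hyx⟩ := h.exists_radical_dvd (maximalIdeal.isMaximal R).isPrime hx hx0
    obtain ⟨z, hz, hzy⟩ : ∃ z ∈ maximalIdeal R, z ∉ Ideal.span {y} := by
      by_contra! hall
      exact hcon y (le_antisymm hall ((Ideal.span_singleton_le_iff_mem _).2 hy))
    exact Ideal.mem_of_dvd _ hyx (h.mem_maximalIdeal_mul_self hy hz hzy)
  obtain ⟨L, hL, hLI⟩ := h.exists_list I
  have hLeq : ∀ Q ∈ L, Q = maximalIdeal R := fun Q hQ => by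
    refine le_antisymm (le_maximalIdeal (hL Q hQ).2) ?_
    rw [← hrad, ← (hL Q hQ).1.radical]
    exact Ideal.radical_mono (hLI ▸ Ideal.list_prod_le_of_mem hQ)
  have hle : maximalIdeal R ≤ I := by
    rw [← hLI, List.eq_replicate_of_mem hLeq, List.prod_replicate]
    rcases Nat.eq_zero_or_pos L.length with h0 | h0
    · simp [h0]
    · exact (IsIdempotentElem.pow_eq (hidem : IsIdempotentElem _) h0.ne').ge
  have hIeq : I = maximalIdeal R := le_antisymm (Ideal.le_radical.trans_eq hrad) hle
  have hbot := Submodule.eq_bot_of_le_smul_of_le_jacobson_bot (maximalIdeal R) (maximalIdeal R)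
    (hIeq ▸ hI) hidem.ge (jacobson_eq_maximalIdeal ⊥ bot_ne_top).ge
  exact hcon 0 (by simpa using hbot)

/-- A nonzero nonunit of a local SP-domain that generates a radical ideal generates the maximal
ideal. -/
theorem maximalIdeal_eq_span (h : IsSPDomain R) {y : R} (hy : y ∈ maximalIdeal R) (hy0 : y ≠ 0)
    (hrad : (Ideal.span {y}).IsRadical) : maximalIdeal R = Ideal.span {y} := by
  have := h.isDomain
  refine le_antisymm (fun z hz => ?_) ((Ideal.span_singleton_le_iff_mem _).2 hy)
  by_contra hzy
  obtain ⟨I, hI, hIN, hyI⟩ :=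
    Ideal.exists_fg_le_mem_mul_self (h.mem_maximalIdeal_mul_self hy hz hzy)
  -- At `P` the maximal ideal is the radical of the finitely generated `I`, hence `(w)`. Now `y = s
  -- w^2` with `(y)` radical puts `w s` in `(y)`, which makes `w` a unit.
  obtain ⟨P, hP, -⟩ := Ideal.exists_minimalPrimes_le hIN
  have := hP.1.1
  let S := Localization.AtPrime P
  have hinj : Function.Injective (algebraMap R S) :=
    IsLocalization.injective S P.primeCompl_le_nonZeroDivisors
  have hradS : (I.map (algebraMap R S)).radical = maximalIdeal S := by
    rw [IsLocalization.AtPrime.radical_map_of_mem_minimalPrimes S P I hP,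
      IsLocalization.AtPrime.map_eq_maximalIdeal]
  obtain ⟨w, hw⟩ := (h.localization P).exists_maximalIdeal_eq_span
    (hI.map (algebraMap R S)) hradS
  have hyS : algebraMap R S y ∈ Ideal.span {w} * Ideal.span {w} := by
    rw [← hw]
    refine Ideal.mul_mono (Ideal.le_radical.trans_eq hradS) (Ideal.le_radical.trans_eq hradS) ?_
    rw [← Ideal.map_mul]
    exact Ideal.mem_map_of_mem _ hyI
  rw [Ideal.span_singleton_mul_span_singleton] at hyS
  obtain ⟨s, hs⟩ := Ideal.mem_span_singleton'.1 hyS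
  have hradS' : (Ideal.span {algebraMap R S y}).IsRadical := by
    rw [← Set.image_singleton, ← Ideal.map_span, ← hrad.radical,
      IsLocalization.map_radical P.primeCompl]
    exact Ideal.radical_isRadical _
  have hws : w * s ∈ Ideal.span {algebraMap R S y} :=
    hradS' ⟨2, Ideal.mem_span_singleton'.2 ⟨s, by rw [← hs]; ring⟩⟩
  obtain ⟨u, hu⟩ := Ideal.mem_span_singleton'.1 hws
  have hyS0 : algebraMap R S y ≠ 0 := fun h0 => hy0 (hinj (h0.trans (map_zero _).symm))
  have hws0 : w * s ≠ 0 := by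
    intro h0
    apply hyS0
    rw [← hs, show s * (w * w) = w * s * w by ring, h0, zero_mul]
  have hwu : w * u = 1 := mul_right_cancel₀ hws0 (by
    rw [one_mul]
    nth_rw 2 [← hu]
    rw [← hs]
    ring)
  have hwm : w ∈ maximalIdeal S := hw ▸ Ideal.mem_span_singleton_self w
  exact (mem_maximalIdeal _).1 hwm (IsUnit.of_mul_eq_one _ hwu)

end Local

/-- Nonzero prime ideals of an SP-domain are maximal. -/
theorem isMaximal_of_isPrime (h : IsSPDomain R) {P : Ideal R} (hP : P.IsPrime) (hP0 : P ≠ ⊥) :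
    P.IsMaximal := by
  have := h.isDomain
  obtain ⟨N, hN, hPN⟩ := Ideal.exists_le_maximal P hP.ne_top
  have := hN.isPrime
  let S := Localization.AtPrime N
  have hinj : Function.Injective (algebraMap R S) :=
    IsLocalization.injective S N.primeCompl_le_nonZeroDivisors
  have hdisj : Disjoint (N.primeCompl : Set R) P :=
    Set.disjoint_left.2 fun x hx hxP => hx (hPN hxP)
  have hPS := IsLocalization.isPrime_of_isPrime_disjoint N.primeCompl S P hP hdisj
  obtain ⟨x, hx, hx0⟩ := Submodule.exists_mem_ne_zero_of_ne_bot hP0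
  obtain ⟨y, hyP, hy0, hyrad, -⟩ := (h.localization N).exists_radical_dvd hPS
    (Ideal.mem_map_of_mem _ hx) (fun h0 => hx0 (hinj (h0.trans (map_zero _).symm)))
  have hmax := (h.localization N).maximalIdeal_eq_span
    (IsLocalRing.le_maximalIdeal hPS.ne_top hyP) hy0 hyrad
  have hle : N ≤ P := by
    rw [← IsLocalization.under_map_of_isPrime_disjoint N.primeCompl S hP hdisj]
    refine Ideal.map_le_iff_le_comap.1 ?_
    rw [IsLocalization.AtPrime.map_eq_maximalIdeal, hmax]
    exact (Ideal.span_singleton_le_iff_mem _).2 hyP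
  exact (le_antisymm hPN hle) ▸ hN

/-- Otherwise each `r = q^2 c` in `Q` has `(q c)^2 ∈ Q`, so `q c ∈ Q` and `Q ≤ qQ`; multiplying by
`Q'` gives `x ∈ q(x)`. -/
theorem exists_mem_not_sq_dvd (h : IsSPDomain R) {q : R} (hq : ¬ IsUnit q) {Q Q' : Ideal R}
    {x : R} (hx : x ≠ 0) (hQ : Q.IsRadical) (e : Q * Q' = Ideal.span {x}) :
    ∃ r ∈ Q, ¬ q ^ 2 ∣ r := by
  have := h.isDomain
  by_contra! hcon
  have hle : Q ≤ Ideal.span {q} * Q := fun r hr => by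
    obtain ⟨c, rfl⟩ := hcon r hr
    refine Ideal.mem_span_singleton_mul.2 ⟨q * c, hQ ⟨2, ?_⟩, by ring⟩
    have := Ideal.mul_mem_left Q c hr
    rwa [show c * (q ^ 2 * c) = (q * c) ^ 2 by ring] at this
  have hx' : x ∈ Ideal.span {q} * Ideal.span {x} := by
    rw [← e, ← mul_assoc]
    exact Ideal.mul_mono_left hle (e ▸ Ideal.mem_span_singleton_self x)
  obtain ⟨z, hz, hzx⟩ := Ideal.mem_mul_span_singleton.1 hx'
  obtain rfl : z = 1 := mul_right_cancel₀ hx (by rw [hzx, one_mul])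
  exact hq (isUnit_of_dvd_one (Ideal.mem_span_singleton.1 hz))

/-- The powers of a prime element of an SP-domain intersect in zero. -/
theorem exists_not_pow_dvd (h : IsSPDomain R) {q : R} (hq : Prime q) {x : R} (hx : x ≠ 0) :
    ∃ n, ¬ q ^ n ∣ x := by
  have := h.isDomain
  obtain ⟨L, hL, hLx⟩ := h.exists_list (Ideal.span {x})
  -- Multiply one element from each factor, none divisible by `q^2`: the prime `q` occurs at most
  -- once per factor. The cofactor `X` keeps every tail a divisor of `(x)`.
  have key : ∀ (L : List (Ideal R)), (∀ Q ∈ L, Q.IsRadical) → (∃ X, X * L.prod = Ideal.span {x}) →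
      ∃ z ∈ L.prod, ¬ q ^ (L.length + 1) ∣ z := by
    intro L
    induction L with
    | nil =>
      intro _ _
      exact ⟨1, by simp, fun hd => hq.not_isUnit (isUnit_of_dvd_one (by simpa using hd))⟩
    | cons Q L ih =>
      rintro hrad ⟨X, hX⟩
      obtain ⟨z, hz, hqz⟩ := ih (fun H hH => hrad H (List.mem_cons_of_mem _ hH))
        ⟨X * Q, by rw [← hX, List.prod_cons, mul_assoc]⟩
      obtain ⟨r, hr, hqr⟩ := h.exists_mem_not_sq_dvd hq.not_isUnit hx
        (hrad Q List.mem_cons_self) (Q' := X * L.prod) (by rw [← hX, List.prod_cons]; ring)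
      refine ⟨r * z, ?_, fun hd => ?_⟩
      · rw [List.prod_cons]
        exact Ideal.mul_mem_mul hr hz
      · rw [List.length_cons] at hd
        by_cases h1 : q ∣ r
        · obtain ⟨s, rfl⟩ := h1
          have hqs : ¬ q ∣ s := fun hs => hqr (by rw [pow_two]; exact mul_dvd_mul_left q hs)
          rw [pow_succ', mul_assoc] at hd
          exact hqz (hq.pow_dvd_of_dvd_mul_left _ hqs ((mul_dvd_mul_iff_left hq.ne_zero).1 hd))
        · exact hqz ((pow_dvd_pow q (Nat.le_succ _)).trans (hq.pow_dvd_of_dvd_mul_left _ h1 hd))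
  obtain ⟨z, hz, hqz⟩ := key L (fun Q hQ => (hL Q hQ).1) ⟨⊤, by rw [Ideal.top_mul, hLx]⟩
  rw [hLx] at hz
  exact ⟨_, fun hd => hqz (hd.trans (Ideal.mem_span_singleton.1 hz))⟩

/-- If every nonzero element of an SP-domain lies in only finitely many maximal ideals, then the
domain is Dedekind. -/
theorem isDedekindDomain_of_finite (h : IsSPDomain R)
    (hfin : ∀ x : R, x ≠ 0 → {N : Ideal R | N.IsMaximal ∧ x ∈ N}.Finite) :
    IsDedekindDomain R := by
  have := h.isDomain
  have hprod : ∀ Q : Ideal R, Q.IsRadical → Q ≠ ⊥ →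
      ∃ s : Finset (Ideal R), (∀ N ∈ s, N.IsMaximal ∧ Q ≤ N) ∧ Q = ∏ N ∈ s, N := by
    intro Q hQ hQ0
    obtain ⟨x, hx, hx0⟩ := Submodule.exists_mem_ne_zero_of_ne_bot hQ0
    have hf : {N : Ideal R | N.IsMaximal ∧ Q ≤ N}.Finite :=
      (hfin x hx0).subset fun N hN => ⟨hN.1, hN.2 hx⟩
    refine ⟨hf.toFinset, fun N hN => by simpa using hN, ?_⟩
    rw [Ideal.prod_eq_iInf_of_pairwise_isCoprime (J := fun N => N)]
    · refine le_antisymm (le_iInf₂ fun N hN => (by simpa using hN : _ ∧ _).2) ?_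
      conv_rhs => rw [← hQ.radical, Ideal.radical_eq_sInf]
      refine le_sInf fun P hP => iInf₂_le P ?_
      have hP0 : P ≠ ⊥ := fun h0 => hQ0 (le_bot_iff.1 (h0 ▸ hP.1))
      simpa using ⟨h.isMaximal_of_isPrime hP.2 hP0, hP.1⟩
    · intro N hN N' hN' hne
      simp only [Set.Finite.coe_toFinset, Set.mem_ofPred_eq] at hN hN'
      exact Ideal.isCoprime_iff_sup_eq.2 (hN.1.coprime_of_ne hN'.1 hne)
  have hmax : ∀ N : Ideal R, N.IsPrime → N ≠ ⊥ → IsInvertibleIdeal N := by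
    intro N hN hN0
    obtain ⟨x, hx, hx0⟩ := Submodule.exists_mem_ne_zero_of_ne_bot hN0
    obtain ⟨Q, Q', hQ, hQN, e⟩ := h.exists_factor_le hN hx
    have hQ0 : Q ≠ ⊥ := by
      rintro rfl
      rw [Ideal.bot_mul] at e
      exact hx0 (Ideal.span_singleton_eq_bot.1 e.symm)
    obtain ⟨s, hs, hQs⟩ := hprod Q hQ hQ0
    obtain ⟨N', hN's, hN'N⟩ := (hN.prod_le).1 (hQs ▸ hQN)
    obtain rfl := (hs N' hN's).1.eq_of_le hN.ne_top hN'N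
    exact ((IsInvertibleIdeal.span_singleton hx0).of_dvd ⟨Q', e.symm⟩).of_dvd
      (hQs ▸ Finset.dvd_prod_of_mem _ hN's)
  refine isDedekindDomain_of_isInvertibleIdeal fun I hI => ?_
  obtain ⟨L, hL, rfl⟩ := h.exists_list I
  refine IsInvertibleIdeal.list_prod fun Q hQ => ?_
  have hQ0 : Q ≠ ⊥ := by
    rintro rfl
    exact hI (List.prod_eq_zero hQ)
  obtain ⟨s, hs, rfl⟩ := hprod Q (hL Q hQ).1 hQ0
  rw [← Finset.prod_toList]
  refine IsInvertibleIdeal.list_prod fun N hN => ?_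
  have hNs := hs N (Finset.mem_toList.1 hN)
  exact hmax N hNs.1.isPrime fun h0 => hQ0 (le_bot_iff.1 (h0 ▸ hNs.2))

end IsSPDomain

/-! ### Factoring ideals of the pullback. -/

section

variable {R : Type*} [CommRing R]

theorem Ideal.exists_eq_span_singleton_mul {I : Ideal R} {x : R} (h : I ≤ Ideal.span {x}) :
    ∃ J : Ideal R, I = Ideal.span {x} * J := by
  refine ⟨Submodule.comap (LinearMap.mulLeft R x) I, le_antisymm (fun a ha => ?_) fun a ha => ?_⟩
  · obtain ⟨b, rfl⟩ := Ideal.mem_span_singleton.1 (h ha)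
    exact Ideal.mem_span_singleton_mul.2 ⟨b, ha, rfl⟩
  · obtain ⟨b, hb, rfl⟩ := Ideal.mem_span_singleton_mul.1 ha
    exact hb

end

/-- The ring `C` is the localization of its subring `A` at the powers of an element `p` that
generates a maximal ideal of `A`, and the maximal ideal `qC` of `C` is contained in `A` and
contains every element of `A` divisible by all powers of `p`. -/
structure IsPrincipalPullback {A C : Type*} [CommRing A] [CommRing C] [Algebra A C]
    (p : A) (q : C) : Prop where
  injective : Function.Injective (algebraMap A C)
  isLocalization : IsLocalization.Away p C
  isMaximal_span : (Ideal.span {p}).IsMaximal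
  ne_zero : p ≠ 0
  isMaximal_span_map : (Ideal.span {q}).IsMaximal
  ne_zero_map : q ≠ 0
  exists_algebraMap_eq : ∀ c : C, ∃ a : A, algebraMap A C a = q * c
  dvd_of_forall_pow_dvd : ∀ a : A, (∀ n : ℕ, p ^ n ∣ a) → q ∣ algebraMap A C a

namespace IsPrincipalPullback

variable {A C : Type*} [CommRing A] [CommRing C] [Algebra A C] {p : A} {q : C}

theorem isUnit_algebraMap (h : IsPrincipalPullback p q) : IsUnit (algebraMap A C p) :=
  have := h.isLocalization
  IsLocalization.Away.algebraMap_isUnit p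

theorem exists_pow_mul (h : IsPrincipalPullback p q) (c : C) :
    ∃ (n : ℕ) (a : A), algebraMap A C p ^ n * c = algebraMap A C a := by
  have := h.isLocalization
  obtain ⟨⟨a, ⟨_, n, rfl⟩⟩, e⟩ := IsLocalization.surj (Submonoid.powers p) c
  exact ⟨n, a, by rw [← e, mul_comm]; simp⟩

theorem exists_mul_eq (h : IsPrincipalPullback p q) (c : C) :
    ∃ a : A, algebraMap A C (p * a) = q * c := by
  obtain ⟨u, hu⟩ := h.isUnit_algebraMap
  obtain ⟨a, ha⟩ := h.exists_algebraMap_eq (↑u⁻¹ * c)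
  refine ⟨a, ?_⟩
  rw [map_mul, ha, ← hu, mul_left_comm, Units.mul_inv_cancel_left]

theorem dvd_of_dvd_algebraMap (h : IsPrincipalPullback p q) {a : A} (ha : q ∣ algebraMap A C a) :
    p ∣ a := by
  obtain ⟨c, hc⟩ := ha
  obtain ⟨b, hb⟩ := h.exists_mul_eq c
  exact ⟨b, h.injective (hc.trans hb.symm)⟩

theorem comap_map_eq_of_div_mem (h : IsPrincipalPullback p q) {I : Ideal A}
    (hI : ∀ x, p * x ∈ I → x ∈ I) : (I.map (algebraMap A C)).comap (algebraMap A C) = I := by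
  have := h.isLocalization
  refine le_antisymm (fun x hx => ?_) Ideal.le_comap_map
  obtain ⟨⟨⟨a, ha⟩, ⟨_, n, rfl⟩⟩, e⟩ :=
    (IsLocalization.mem_map_algebraMap_iff (Submonoid.powers p) C).1 (Ideal.mem_comap.1 hx)
  rw [← map_mul] at e
  have hn : p ^ n * x ∈ I := by
    rw [mul_comm, show x * p ^ n = a from h.injective e]
    exact ha
  clear e
  induction n with
  | zero => simpa using hn
  | succ n ih => exact ih (hI _ (by rwa [← mul_assoc, ← pow_succ']))

/-- Since `pA` is maximal, `b` and `p` are comaximal. -/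
theorem div_mem_of_notMem (h : IsPrincipalPullback p q) {I : Ideal A} {b : A}
    (hb : b ∉ Ideal.span {p}) {x : A} (hbx : b * x ∈ I) (hpx : p * x ∈ I) : x ∈ I := by
  have := h.isMaximal_span
  obtain ⟨b', z, hz, e⟩ := this.exists_inv hb
  obtain ⟨c, rfl⟩ := Ideal.mem_span_singleton.1 hz
  have : x = b' * (b * x) + c * (p * x) := by linear_combination -x * e
  rw [this]
  exact I.add_mem (I.mul_mem_left _ hbx) (I.mul_mem_left _ hpx)

theorem comap_map_eq_of_not_le (h : IsPrincipalPullback p q) {I : Ideal A}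
    (hI : ¬ I ≤ Ideal.span {p}) : (I.map (algebraMap A C)).comap (algebraMap A C) = I := by
  obtain ⟨b, hb, hbp⟩ := SetLike.not_le_iff_exists.1 hI
  exact h.comap_map_eq_of_div_mem fun x hx =>
    h.div_mem_of_notMem hbp (I.mul_mem_right _ hb) hx

theorem map_comap_list_prod (h : IsPrincipalPullback p q) (L : List (Ideal C)) :
    ((L.map (Ideal.comap (algebraMap A C))).prod).map (algebraMap A C) = L.prod := by
  have := h.isLocalization
  induction L with
  | nil => simp [Ideal.one_eq_top, Ideal.map_top]
  | cons Q L ih =>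
    rw [List.map_cons, List.prod_cons, Ideal.map_mul, ih, List.prod_cons]
    congr 1
    exact IsLocalization.map_under (Submonoid.powers p) C Q

/-- By maximality `Q` contains some `1 - q c`, and `q c` lies in `pA`. -/
theorem comap_not_le (h : IsPrincipalPullback p q) {Q : Ideal C}
    (hQ : ¬ Q ≤ Ideal.span {q}) : ¬ Q.comap (algebraMap A C) ≤ Ideal.span {p} := by
  intro hle
  obtain ⟨r, hr, hrq⟩ := SetLike.not_le_iff_exists.1 hQ
  have := h.isMaximal_span_map
  obtain ⟨r', z, hz, e⟩ := this.exists_inv hrq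
  obtain ⟨c, rfl⟩ := Ideal.mem_span_singleton.1 hz
  obtain ⟨b, hb⟩ := h.exists_mul_eq c
  have hmem : 1 - p * b ∈ Q.comap (algebraMap A C) := by
    rw [Ideal.mem_comap, map_sub, map_one, hb, show 1 - q * c = r' * r by linear_combination -e]
    exact Q.mul_mem_left _ hr
  refine h.isMaximal_span.ne_top ((Ideal.eq_top_iff_one _).2 ?_)
  have := Ideal.add_mem _ (hle hmem) (Ideal.mul_mem_right b _ (Ideal.mem_span_singleton_self p))
  rwa [sub_add_cancel] at this

theorem comap_span_le (h : IsPrincipalPullback p q) :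
    (Ideal.span {q}).comap (algebraMap A C) ≤ Ideal.span {p} := fun _ ha =>
  Ideal.mem_span_singleton.2
    (h.dvd_of_dvd_algebraMap (Ideal.mem_span_singleton.1 (Ideal.mem_comap.1 ha)))

theorem forall_mem_map_comap {L : List (Ideal C)} (hL : ∀ Q ∈ L, Q.IsRadical ∧ Q ≠ ⊤) :
    ∀ H ∈ L.map (Ideal.comap (algebraMap A C)), H ≠ ⊤ ∧ H.IsRadical := by
  intro H hH
  obtain ⟨Q, hQ, rfl⟩ := List.mem_map.1 hH
  exact ⟨Ideal.comap_ne_top _ (hL Q hQ).2, (hL Q hQ).1.comap _⟩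

theorem exists_list_of_not_le (h : IsPrincipalPullback p q) (hC : IsSPDomain C) {I : Ideal A}
    (hI : ¬ I ≤ Ideal.span {p}) :
    ∃ L : List (Ideal A), (∀ H ∈ L, H ≠ ⊤ ∧ H.IsRadical) ∧ L.prod = I := by
  obtain ⟨L, hL, hLI⟩ := hC.exists_list (I.map (algebraMap A C))
  refine ⟨_, forall_mem_map_comap hL, ?_⟩
  have hnot : ¬ (L.map (Ideal.comap (algebraMap A C))).prod ≤ Ideal.span {p} := by
    intro hle
    obtain ⟨H, hH, hHp⟩ := h.isMaximal_span.isPrime.exists_mem_le_of_list_prod_le hle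
    obtain ⟨Q, hQ, rfl⟩ := List.mem_map.1 hH
    refine h.comap_not_le (fun hQq => hI ?_) hHp
    refine le_trans ?_ h.comap_span_le
    rw [← Ideal.map_le_iff_le_comap, ← hLI]
    exact (Ideal.list_prod_le_of_mem hQ).trans hQq
  rw [← h.comap_map_eq_of_not_le hnot, h.map_comap_list_prod, hLI, h.comap_map_eq_of_not_le hI]

theorem exists_factorization_of_le [IsDomain A] (h : IsPrincipalPullback p q) (hC : IsSPDomain C)
    {I : Ideal A} {g : A} (hg : g ≠ 0) (hle : I ≤ Ideal.span {p * g})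
    (hnot : ¬ I ≤ Ideal.span {p * (p * g)}) :
    ∃ (J : Ideal A) (Q : List (Ideal A)), IsInvertibleIdeal J ∧ Q ≠ [] ∧
      (∀ H ∈ Q, H ≠ ⊤ ∧ H.IsRadical) ∧ I = J * Q.prod := by
  obtain ⟨I, rfl⟩ := Ideal.exists_eq_span_singleton_mul hle
  have hI : ¬ I ≤ Ideal.span {p} := fun hI => hnot <| by
    exact (Ideal.mul_mono_right hI).trans_eq
      (by rw [Ideal.span_singleton_mul_span_singleton, mul_comm p (p * g)])
  obtain ⟨L, hL, rfl⟩ := h.exists_list_of_not_le hC hI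
  refine ⟨Ideal.span {g}, Ideal.span {p} :: L, .span_singleton hg, by simp, ?_, ?_⟩
  · intro H hH
    rcases List.mem_cons.1 hH with rfl | hH
    · exact ⟨h.isMaximal_span.ne_top, h.isMaximal_span.isPrime.isRadical⟩
    · exact hL H hH
  · rw [List.prod_cons, ← mul_assoc, Ideal.span_singleton_mul_span_singleton, mul_comm g]

/-- An ideal of `A` that is an ideal of `C` contained in `qC` factors as in `C`. -/
theorem exists_factorization_of_div_mem [IsDomain A] (h : IsPrincipalPullback p q)
    (hC : IsSPDomain C) {I : Ideal A} (hI : ∀ x, p * x ∈ I → x ∈ I) {j : ℕ}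
    (hle : I.map (algebraMap A C) ≤ Ideal.span {q ^ (j + 1)}) :
    ∃ (J : Ideal A) (Q : List (Ideal A)), IsInvertibleIdeal J ∧ Q ≠ [] ∧
      (∀ H ∈ Q, H ≠ ⊤ ∧ H.IsRadical) ∧ I = J * Q.prod := by
  have := hC.isDomain
  obtain ⟨I', hI'⟩ := Ideal.exists_eq_span_singleton_mul hle
  obtain ⟨L, hL, rfl⟩ := hC.exists_list I'
  obtain ⟨g, hg⟩ : ∃ g : A, algebraMap A C g = q ^ j := by
    cases j with
    | zero => exact ⟨1, by simp⟩
    | succ j =>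
      obtain ⟨g, hg⟩ := h.exists_algebraMap_eq (q ^ j)
      exact ⟨g, by rw [hg, pow_succ']⟩
  have hg0 : g ≠ 0 := by
    rintro rfl
    rw [map_zero] at hg
    exact pow_ne_zero j h.ne_zero_map hg.symm
  have hL' : ∀ Q ∈ Ideal.span {q} :: L, Q.IsRadical ∧ Q ≠ ⊤ := by
    intro Q hQ
    rcases List.mem_cons.1 hQ with rfl | hQ
    · exact ⟨h.isMaximal_span_map.isPrime.isRadical, h.isMaximal_span_map.ne_top⟩
    · exact hL Q hQ
  refine ⟨Ideal.span {g}, (Ideal.span {q} :: L).map (Ideal.comap (algebraMap A C)),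
    .span_singleton hg0, by simp, forall_mem_map_comap hL', ?_⟩
  -- The contraction of `qC` equals `p` times itself, so a product containing it is stable under
  -- division by `p`, hence contracted from `C`.
  have hcl : ∀ x, p * x ∈ Ideal.span {g} *
      ((Ideal.span {q} :: L).map (Ideal.comap (algebraMap A C))).prod →
      x ∈ Ideal.span {g} *
      ((Ideal.span {q} :: L).map (Ideal.comap (algebraMap A C))).prod := by
    intro x hx
    have hM : (Ideal.span {q}).comap (algebraMap A C) ≤
        Ideal.span {p} * (Ideal.span {q}).comap (algebraMap A C) := by
      intro a ha
      obtain ⟨c, hc⟩ := Ideal.mem_span_singleton.1 (Ideal.mem_comap.1 ha)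
      obtain ⟨u, hu⟩ := h.isUnit_algebraMap
      obtain ⟨b, hb⟩ := h.exists_algebraMap_eq (↑u⁻¹ * c)
      refine Ideal.mem_span_singleton_mul.2 ⟨b, ?_, h.injective ?_⟩
      · rw [Ideal.mem_comap, hb]
        exact Ideal.mem_span_singleton.2 (dvd_mul_right _ _)
      · rw [map_mul, hb, hc, ← hu, mul_left_comm, Units.mul_inv_cancel_left]
    rw [List.map_cons, List.prod_cons, mul_left_comm] at hx ⊢
    replace hx := Ideal.mul_mono_left hM hx
    rw [mul_assoc] at hx
    obtain ⟨y, hy, hyx⟩ := Ideal.mem_span_singleton_mul.1 hx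
    rwa [← mul_left_cancel₀ h.ne_zero hyx]
  rw [← h.comap_map_eq_of_div_mem hI, ← h.comap_map_eq_of_div_mem hcl, Ideal.map_mul,
    h.map_comap_list_prod, hI', Ideal.map_span, Set.image_singleton, hg, List.prod_cons,
    ← mul_assoc, Ideal.span_singleton_mul_span_singleton, pow_succ]

theorem exists_pow_mul_eq_notMem (h : IsPrincipalPullback p q) {c : C} {N : ℕ}
    (hc : ∀ b, algebraMap A C p ^ N * c ≠ algebraMap A C b) :
    ∃ n ≥ N, ∃ b ∉ Ideal.span {p}, algebraMap A C p ^ n * c = algebraMap A C b := by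
  classical
  have hex := h.exists_pow_mul c
  obtain ⟨b, hb⟩ := Nat.find_spec hex
  have hN : N < Nat.find hex := by
    by_contra! hle
    refine hc (p ^ (N - Nat.find hex) * b) ?_
    rw [map_mul, ← hb, map_pow, ← mul_assoc, ← pow_add, Nat.sub_add_cancel hle]
  refine ⟨_, hN.le, b, fun hbp => ?_, hb⟩
  obtain ⟨b', rfl⟩ := Ideal.mem_span_singleton.1 hbp
  refine Nat.find_min hex (Nat.sub_one_lt_of_lt hN) ⟨b', h.isUnit_algebraMap.mul_left_cancel ?_⟩
  rw [← mul_assoc, ← pow_succ', Nat.sub_add_cancel (Nat.one_le_of_lt hN), hb, map_mul]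

theorem isISPDomain [IsDomain A] (h : IsPrincipalPullback p q) (hC : IsSPDomain C) :
    IsISPDomain A := by
  have := hC.isDomain
  refine ⟨inferInstance, fun I hItop hIbot => ?_⟩
  by_cases hp : ∃ n, ¬ I ≤ Ideal.span {p ^ n}
  · classical
    have hspec := Nat.find_spec hp
    have hmin := fun m => @Nat.find_min _ _ hp m
    match hn : Nat.find hp, hspec, hmin with
    | 0, hspec, _ => simp at hspec
    | 1, hspec, _ =>
      obtain ⟨L, hL, rfl⟩ := h.exists_list_of_not_le hC (by simpa using hspec)
      refine ⟨⊤, L, by simp [IsInvertibleIdeal], ?_, hL, by rw [Ideal.top_mul]⟩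
      rintro rfl
      exact hItop (by simp [Ideal.one_eq_top])
    | n + 2, hspec, hmin =>
      refine h.exists_factorization_of_le hC (pow_ne_zero n h.ne_zero) ?_ ?_
      · rw [← pow_succ']
        exact not_not.1 (hmin (n + 1) (by omega))
      · rwa [← pow_succ', ← pow_succ']
  push Not at hp
  have hq : Prime q := (Ideal.span_singleton_prime h.ne_zero_map).1 h.isMaximal_span_map.isPrime
  have hqI : ∀ a ∈ I, q ∣ algebraMap A C a := fun a ha =>
    h.dvd_of_forall_pow_dvd a fun n => Ideal.mem_span_singleton.1 (hp n ha)
  obtain ⟨j, hj, a₀, ha₀, hja₀⟩ : ∃ j, (∀ a ∈ I, q ^ (j + 1) ∣ algebraMap A C a) ∧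
      ∃ a ∈ I, ¬ q ^ (j + 2) ∣ algebraMap A C a := by
    classical
    obtain ⟨x, hx, hx0⟩ := Submodule.exists_mem_ne_zero_of_ne_bot hIbot
    obtain ⟨n, hn⟩ := hC.exists_not_pow_dvd hq
      (fun h0 => hx0 (h.injective (h0.trans (map_zero _).symm)))
    have hex : ∃ n, ∃ a ∈ I, ¬ q ^ n ∣ algebraMap A C a := ⟨n, x, hx, hn⟩
    have hspec := Nat.find_spec hex
    have hmin := fun m => @Nat.find_min _ _ hex m
    match hn : Nat.find hex, hspec, hmin with
    | 0, hspec, _ => simp at hspec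
    | 1, hspec, _ =>
      obtain ⟨a, ha, hqa⟩ := hspec
      exact absurd (hqI a ha) (by simpa using hqa)
    | n + 2, hspec, hmin =>
      refine ⟨n, fun a ha => ?_, hspec⟩
      have := hmin (n + 1) (by omega)
      push Not at this
      exact this a ha
  obtain ⟨u, hu⟩ := h.isUnit_algebraMap
  -- Negative `m` is allowed because `qC` lies in `A`; so a factor `p` can always be split off `g
  -- m`.
  have hlift : ∀ m : ℤ, ∃ g : A, algebraMap A C g = q ^ (j + 1) * ((u ^ m : Cˣ) : C) := fun m => by
    obtain ⟨g, hg⟩ := h.exists_algebraMap_eq (q ^ j * ((u ^ m : Cˣ) : C))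
    exact ⟨g, by rw [hg, pow_succ', mul_assoc]⟩
  choose g hg using hlift
  have hgsucc : ∀ m, g (m + 1) = p * g m := fun m => h.injective <| by
    rw [map_mul, hg, hg, ← hu, zpow_add_one, Units.val_mul]
    ring
  have hg0 : ∀ m, g m ≠ 0 := fun m h0 => by
    have := hg m
    rw [h0, map_zero] at this
    exact mul_ne_zero (pow_ne_zero _ h.ne_zero_map) (Units.ne_zero _) this.symm
  have hgdvd : ∀ m (n : ℕ), g m * p ^ n = g (m + n) := fun m n => by
    induction n with
    | zero => simp
    | succ n ih =>
      rw [pow_succ, ← mul_assoc, ih, Nat.cast_succ, ← add_assoc, hgsucc, mul_comm]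
  by_cases hex : ∃ m, I ≤ Ideal.span {g m}
  · obtain ⟨m, hm⟩ := hex
    obtain ⟨n, hn⟩ : ∃ n : ℕ, ¬ I ≤ Ideal.span {g (m + n)} := by
      by_contra! hall
      have hall' : ∀ m', I ≤ Ideal.span {g m'} := fun m' => by
        refine (hall (m' - m).toNat).trans (Ideal.span_singleton_le_span_singleton.2 ?_)
        obtain ⟨n, hn⟩ := Int.le.dest (show m' ≤ m + (m' - m).toNat by omega)
        rw [← hn, ← hgdvd]
        exact dvd_mul_right _ _
      obtain ⟨b, hb⟩ := Ideal.mem_span_singleton.1 (hall' 0 ha₀)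
      have hqb : q ∣ algebraMap A C b := by
        refine h.dvd_of_forall_pow_dvd b fun n => ?_
        obtain ⟨b', hb'⟩ := Ideal.mem_span_singleton.1 (hall' (0 + n) ha₀)
        rw [← hgdvd, hb, mul_assoc] at hb'
        exact ⟨b', mul_left_cancel₀ (hg0 0) hb'⟩
      refine hja₀ ?_
      rw [hb, map_mul, hg, zpow_zero, Units.val_one, mul_one, pow_succ]
      exact mul_dvd_mul_left _ hqb
    obtain ⟨m', hm', hnm'⟩ : ∃ m', I ≤ Ideal.span {g m'} ∧ ¬ I ≤ Ideal.span {g (m' + 1)} := by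
      by_contra! hall
      refine hn ?_
      clear hn
      induction n with
      | zero => simpa using hm
      | succ n ih =>
        rw [Nat.cast_succ, ← add_assoc]
        exact hall _ ih
    have hm1 : g m' = p * g (m' - 1) := by rw [← hgsucc, sub_add_cancel]
    rw [hgsucc, hm1] at hnm'
    exact h.exists_factorization_of_le hC (hg0 (m' - 1)) (hm1 ▸ hm') hnm'
  · push Not at hex
    refine h.exists_factorization_of_div_mem hC (j := j) (fun x hx => ?_) ?_
    -- Write `x = q^(j+1) t` with `p^N t = s` in `A`. Some `a = q^(j+1) c` in `I` has `p^N c`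
    -- outside `A`, so a later `b = p^n c` is in `A` but not in `pA`. Then `b x = p^(n-N) s a` lies
    -- in `I`, as does `p x`.
    · obtain ⟨t, ht⟩ : q ^ (j + 1) ∣ algebraMap A C x := by
        have := hj _ hx
        rwa [map_mul, h.isUnit_algebraMap.dvd_mul_left] at this
      obtain ⟨N, s, hs⟩ := h.exists_pow_mul t
      obtain ⟨a, ha, hga⟩ := SetLike.not_le_iff_exists.1 (hex (-(N : ℤ)))
      obtain ⟨c, hc⟩ := hj a ha
      obtain ⟨n, hn, b, hb, hbc⟩ := h.exists_pow_mul_eq_notMem (c := c) (N := N) fun b hb => by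
        refine hga (Ideal.mem_span_singleton.2 ⟨b, h.injective ?_⟩)
        rw [map_mul, hg, ← hb, hc, ← hu, zpow_neg, zpow_natCast, mul_assoc, ← Units.val_pow_eq_pow_val,
          Units.inv_mul_cancel_left]
      refine h.div_mem_of_notMem hb ?_ hx
      have : b * x = p ^ (n - N) * s * a := h.injective <| by
        rw [map_mul, map_mul, map_mul, map_pow, ← hbc, ← hs, ht, hc]
        obtain ⟨d, rfl⟩ := Nat.exists_eq_add_of_le hn
        rw [Nat.add_sub_cancel_left]
        ring
      rw [this]
      exact I.mul_mem_left _ ha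
    · rw [Ideal.map_le_iff_le_comap]
      exact fun a ha => Ideal.mem_span_singleton.2 (hj a ha)

end IsPrincipalPullback

/-! ### Krull dimension and failure of h-locality. -/

theorem Ideal.finite_setOf_isMaximal_of_finite_quotient {R : Type*} [CommRing R] (I : Ideal R)
    [Finite (MaximalSpectrum (R ⧸ I))] : {N : Ideal R | N.IsMaximal ∧ I ≤ N}.Finite := by
  refine (Set.finite_range fun m : MaximalSpectrum (R ⧸ I) =>
    m.asIdeal.comap (Ideal.Quotient.mk I)).subset fun N hN => ?_
  have := hN.1
  have hmax : (N.map (Ideal.Quotient.mk I)).IsMaximal :=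
    Ideal.IsMaximal.map_of_surjective_of_ker_le Ideal.Quotient.mk_surjective
      (by rw [Ideal.mk_ker]; exact hN.2)
  refine ⟨⟨_, hmax⟩, ?_⟩
  change (N.map (Ideal.Quotient.mk I)).comap (Ideal.Quotient.mk I) = N
  rw [Ideal.comap_map_of_surjective _ Ideal.Quotient.mk_surjective, ← RingHom.ker_eq_comap_bot,
    Ideal.mk_ker, sup_eq_left.2 hN.2]

namespace IsPrincipalPullback

variable {A C : Type*} [CommRing A] [CommRing C] [Algebra A C] {p : A} {q : C}

theorem disjoint_powers {P : Ideal A} (hP : P.IsPrime) (hp : p ∉ P) :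
    Disjoint (Submonoid.powers p : Set A) P := by
  rw [Set.disjoint_left]
  rintro _ ⟨n, rfl⟩ hn
  exact hp (hP.mem_of_pow_mem n hn)

theorem eq_span_of_mem (h : IsPrincipalPullback p q) {P : Ideal A} (hP : P.IsPrime) (hp : p ∈ P) :
    P = Ideal.span {p} :=
  (h.isMaximal_span.eq_of_le hP.ne_top ((Ideal.span_singleton_le_iff_mem _).2 hp)).symm

/-- Primes avoiding `p` correspond to primes of `C`, whose nonzero primes are maximal. -/
theorem mem_of_lt (h : IsPrincipalPullback p q) (hC : IsSPDomain C) {P P' : Ideal A}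
    (hP : P.IsPrime) (hP' : P'.IsPrime) (hP0 : P ≠ ⊥) (hlt : P < P') : p ∈ P' := by
  by_contra hp
  have := h.isLocalization
  have hd := disjoint_powers hP fun hpP => hp (hlt.le hpP)
  have hd' := disjoint_powers hP' hp
  have h1 := IsLocalization.isPrime_of_isPrime_disjoint (Submonoid.powers p) C P hP hd
  have h2 := IsLocalization.isPrime_of_isPrime_disjoint (Submonoid.powers p) C P' hP' hd'
  have h3 := hC.isMaximal_of_isPrime h1 fun h0 =>
    hP0 ((Ideal.map_eq_bot_iff_of_injective h.injective).1 h0)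
  have h4 := h3.eq_of_le h2.ne_top (Ideal.map_mono hlt.le)
  have h5 := congrArg (Ideal.under A) h4
  rw [IsLocalization.under_map_of_isPrime_disjoint (Submonoid.powers p) C hP hd,
    IsLocalization.under_map_of_isPrime_disjoint (Submonoid.powers p) C hP' hd'] at h5
  exact hlt.ne h5

theorem ringKrullDim_eq_two [IsDomain A] (h : IsPrincipalPullback p q) (hC : IsSPDomain C) :
    ringKrullDim A = 2 := by
  refine le_antisymm (iSup_le fun l => ?_) ?_
  · by_contra hlen
    have hl : 3 ≤ l.length := by
      by_contra! hl
      exact hlen (by exact_mod_cast (show l.length ≤ 2 by omega))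
    have hlt : ∀ i (hi : i < l.length), (l ⟨i, by omega⟩).asIdeal < (l ⟨i + 1, by omega⟩).asIdeal :=
      fun i hi => l.step ⟨i, hi⟩
    have hp := h.mem_of_lt hC (l ⟨1, by omega⟩).isPrime (l ⟨2, by omega⟩).isPrime
      (bot_le.trans_lt (hlt 0 (by omega))).ne' (hlt 1 (by omega))
    have heq := h.eq_span_of_mem (l ⟨2, by omega⟩).isPrime hp
    have hmax := h.isMaximal_span
    rw [← heq] at hmax
    exact (hlt 2 (by omega)).ne
      (hmax.eq_of_le (l ⟨3, by omega⟩).isPrime.ne_top (hlt 2 (by omega)).le)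
  · have := h.isMaximal_span.isPrime
    have := h.isMaximal_span_map.isPrime
    let P₀ : PrimeSpectrum A := ⟨⊥, Ideal.isPrime_bot⟩
    let P₁ : PrimeSpectrum A := ⟨(Ideal.span {q}).comap (algebraMap A C), inferInstance⟩
    let P₂ : PrimeSpectrum A := ⟨Ideal.span {p}, inferInstance⟩
    have h01 : P₀ < P₁ := by
      refine lt_of_le_of_ne (bot_le : (⊥ : Ideal A) ≤ _) fun e => ?_
      obtain ⟨a, ha⟩ := h.exists_algebraMap_eq 1
      rw [mul_one] at ha
      have haP : a ∈ P₁.asIdeal := by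
        rw [Ideal.mem_comap, ha]
        exact Ideal.mem_span_singleton_self q
      rw [← e] at haP
      rw [(Ideal.mem_bot.1 haP), map_zero] at ha
      exact h.ne_zero_map ha.symm
    have h12 : P₁ < P₂ := by
      refine lt_of_le_of_ne h.comap_span_le fun e => ?_
      have hpP : p ∈ P₁.asIdeal := by
        rw [e]
        exact Ideal.mem_span_singleton_self p
      exact h.isMaximal_span_map.ne_top
        (Ideal.eq_top_of_isUnit_mem _ (Ideal.mem_comap.1 hpP) h.isUnit_algebraMap)
    let l : LTSeries (PrimeSpectrum A) :=
      { length := 2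
        toFun := ![P₀, P₁, P₂]
        step := by
          intro i
          fin_cases i
          · exact h01
          · exact h12 }
    exact Order.LTSeries.length_le_krullDim l

theorem isMaximal_comap (h : IsPrincipalPullback p q) {N : Ideal C} (hN : N.IsMaximal)
    (hne : N ≠ Ideal.span {q}) : (N.comap (algebraMap A C)).IsMaximal := by
  obtain ⟨N', hN', hle⟩ := Ideal.exists_le_maximal _ (Ideal.comap_ne_top (algebraMap A C) hN.ne_top)
  have := h.isLocalization
  by_cases hp : p ∈ N'
  · rw [h.eq_span_of_mem hN'.isPrime hp] at hle
    exact absurd hle (h.comap_not_le fun hNq => hne (hN.eq_of_le h.isMaximal_span_map.ne_top hNq))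
  · have hd := disjoint_powers hN'.isPrime hp
    have h1 := IsLocalization.isPrime_of_isPrime_disjoint (Submonoid.powers p) C N' hN'.isPrime hd
    have h2 : N = N'.map (algebraMap A C) := hN.eq_of_le h1.ne_top <| by
      rw [← IsLocalization.map_under (Submonoid.powers p) C N]
      exact Ideal.map_mono hle
    have h3 := IsLocalization.under_map_of_isPrime_disjoint (Submonoid.powers p) C hN'.isPrime hd
    rw [← h2] at h3
    exact (show N.comap (algebraMap A C) = N' from h3) ▸ hN'

theorem isDedekindDomain_of_isHLocal (h : IsPrincipalPullback p q) (hC : IsSPDomain C)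
    (hA : IsHLocal A) : IsDedekindDomain C := by
  have := hC.isDomain
  have := h.isLocalization
  refine hC.isDedekindDomain_of_finite fun x hx => ?_
  -- Passing to `q x` moves `x` into `A` and adds only the maximal ideal `qC` to those containing
  -- it.
  obtain ⟨a, ha⟩ := h.exists_algebraMap_eq x
  have ha0 : a ≠ 0 := by
    rintro rfl
    rw [map_zero] at ha
    exact mul_ne_zero h.ne_zero_map hx ha.symm
  have := hA.finite_maximalSpectrum_quotient (Ideal.span {a})
    (by simpa [Ideal.span_singleton_eq_bot] using ha0)
  refine (((Ideal.finite_setOf_isMaximal_of_finite_quotient (Ideal.span {a})).preimage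
    (f := Ideal.comap (algebraMap A C)) ?_).insert (Ideal.span {q})).subset fun N hN => ?_
  · intro N _ N' _ e
    rw [← IsLocalization.map_under (Submonoid.powers p) C N,
      ← IsLocalization.map_under (Submonoid.powers p) C N']
    exact congrArg (Ideal.map (algebraMap A C)) e
  · by_cases hne : N = Ideal.span {q}
    · exact Or.inl hne
    · refine Or.inr ⟨h.isMaximal_comap hN.1 hne, ?_⟩
      rw [Ideal.span_singleton_le_iff_mem, Ideal.mem_comap, ha]
      exact N.mul_mem_left _ hN.2

end IsPrincipalPullback

/-! ### The given pullback and the conclusion. -/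

theorem isPrincipalPullback_comap {C : Type*} [CommRing C] [IsDomain C] (M : Ideal C)
    [M.IsMaximal] {q : C} (hM : M = Ideal.span {q}) (hq : q ≠ 0) (D : Subring (C ⧸ M))
    [IsDiscreteValuationRing D] [IsFractionRing D (C ⧸ M)] (p : Cˣ)
    (hpD : Ideal.Quotient.mk M (p : C) ∈ D)
    (hp : IsLocalRing.maximalIdeal D = Ideal.span {⟨Ideal.Quotient.mk M (p : C), hpD⟩}) :
    IsPrincipalPullback (A := D.comap (Ideal.Quotient.mk M)) ⟨(p : C), hpD⟩ q := by
  have hinj : Function.Injective (algebraMap (D.comap (Ideal.Quotient.mk M)) C) :=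
    Subtype.val_injective
  have hmem : ∀ m ∈ M, m ∈ D.comap (Ideal.Quotient.mk M) := fun m hm => by
    rw [Subring.mem_comap, Ideal.Quotient.eq_zero_iff_mem.2 hm]
    exact D.zero_mem
  let f : D.comap (Ideal.Quotient.mk M) →+* D :=
    ((Ideal.Quotient.mk M).comp (D.comap (Ideal.Quotient.mk M)).subtype).codRestrict D
      fun a => a.2
  have hf : Function.Surjective f := by
    rintro ⟨d, hd⟩
    obtain ⟨c, rfl⟩ := Ideal.Quotient.mk_surjective d
    exact ⟨⟨c, hd⟩, rfl⟩
  set p' : D.comap (Ideal.Quotient.mk M) := ⟨(p : C), hpD⟩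
  have hp0 : p' ≠ 0 := fun h0 => p.ne_zero (congrArg Subtype.val h0)
  have hfp : IsLocalRing.maximalIdeal D = Ideal.span {f p'} := hp
  have hdiv : ∀ m ∈ M, ∃ b : D.comap (Ideal.Quotient.mk M), m = p * b := fun m hm =>
    ⟨⟨(↑p⁻¹ : C) * m, hmem _ (M.mul_mem_left _ hm)⟩, by simp⟩
  refine ⟨hinj, ?_, ?_, hp0, hM ▸ inferInstance, hq, fun c => ?_, fun a ha => ?_⟩
  · refine (isLocalization_iff _ _).2 ⟨?_, fun c => ?_, fun {x y} e => ⟨1, by rw [hinj e]⟩⟩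
    · rintro ⟨_, n, rfl⟩
      rw [map_pow]
      exact p.isUnit.pow n
    -- The denominator is a unit times a power of the uniformizer, so that power of `p` brings `c`
    -- into `A`.
    · obtain ⟨⟨x, y⟩, e⟩ := IsLocalization.surj (nonZeroDivisors D) (Ideal.Quotient.mk M c)
      have hirr : Irreducible (f p') :=
        (IsDiscreteValuationRing.irreducible_iff_uniformizer _).2 hfp
      obtain ⟨n, u, hu⟩ := IsDiscreteValuationRing.eq_unit_mul_pow_irreducible
        (nonZeroDivisors.ne_zero y.2) hirr
      have hmemD : c * (p : C) ^ n ∈ D.comap (Ideal.Quotient.mk M) := by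
        rw [Subring.mem_comap]
        have : Ideal.Quotient.mk M (c * (p : C) ^ n) = ((↑u⁻¹ * x : D) : C ⧸ M) := by
          have e' : Ideal.Quotient.mk M c * ((y : D) : C ⧸ M) = (x : C ⧸ M) := e
          rw [map_mul, map_pow, Subring.coe_mul, ← e', hu, Subring.coe_mul]
          have huu : (((↑u⁻¹ : D)) : C ⧸ M) * ((↑u : D) : C ⧸ M) = 1 := by
            rw [← Subring.coe_mul, Units.inv_mul, Subring.coe_one]
          have hpp : ((f p' ^ n : D) : C ⧸ M) = Ideal.Quotient.mk M (p : C) ^ n := rfl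
          rw [hpp]
          linear_combination
            -(Ideal.Quotient.mk M c * Ideal.Quotient.mk M (p : C) ^ n) * huu
        rw [this]
        exact Subtype.property _
      exact ⟨(⟨_, hmemD⟩, ⟨p' ^ n, n, rfl⟩), rfl⟩
  · have hcomap : Ideal.span {p'} = (IsLocalRing.maximalIdeal D).comap f := by
      refine le_antisymm ?_ fun a ha => ?_
      · rw [Ideal.span_singleton_le_iff_mem, Ideal.mem_comap, hfp]
        exact Ideal.mem_span_singleton_self _
      · rw [Ideal.mem_comap, hfp] at ha
        obtain ⟨d, hd⟩ := Ideal.mem_span_singleton.1 ha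
        obtain ⟨b, rfl⟩ := hf d
        -- The error term in `M` is again `p` times an element of `A`, as `p` is a unit of `C`.
        have hm : (a : C) - p * b ∈ M := by
          rw [← Ideal.Quotient.eq_zero_iff_mem, map_sub, map_mul, sub_eq_zero]
          exact congrArg Subtype.val hd
        obtain ⟨m, hm'⟩ := hdiv _ hm
        exact Ideal.mem_span_singleton.2 ⟨b + m, Subtype.ext <| by
          change (a : C) = p * (b + m)
          linear_combination hm'⟩
    rw [hcomap]
    exact Ideal.comap_isMaximal_of_surjective f hf
  · exact ⟨⟨q * c, hmem _ (hM ▸ Ideal.mul_mem_right _ _ (Ideal.mem_span_singleton_self q))⟩, rfl⟩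
  · have hfa : f a ∈ ⨅ n, IsLocalRing.maximalIdeal D ^ n := by
      rw [Submodule.mem_iInf]
      intro n
      rw [hfp, Ideal.span_singleton_pow, Ideal.mem_span_singleton, ← map_pow]
      exact map_dvd f (ha n)
    rw [Ideal.iInf_pow_eq_bot_of_isLocalRing _ (IsLocalRing.maximalIdeal.isMaximal D).ne_top,
      Ideal.mem_bot] at hfa
    have : (a : C) ∈ M := Ideal.Quotient.eq_zero_iff_mem.1 (congrArg Subtype.val hfa)
    exact Ideal.mem_span_singleton.1 (hM.le this)

theorem proposition4p1 {C : Type*} [CommRing C] (hSP : IsSPDomain C)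
    (hDed : ¬ IsDedekindDomain C)
    (M : Ideal C) [M.IsMaximal] (q : C) (hM : M = Ideal.span {q})
    (D : Subring (C ⧸ M)) [IsDiscreteValuationRing D] [IsFractionRing D (C ⧸ M)]
    (hp : ∃ (p : Cˣ) (hpD : Ideal.Quotient.mk M (p : C) ∈ D),
      IsLocalRing.maximalIdeal D = Ideal.span {⟨Ideal.Quotient.mk M (p : C), hpD⟩}) :
    IsISPDomain (D.comap (Ideal.Quotient.mk M)) ∧
      ringKrullDim (D.comap (Ideal.Quotient.mk M)) = 2 ∧
      ¬ IsHLocal (D.comap (Ideal.Quotient.mk M)) := by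
  have := hSP.isDomain
  obtain ⟨p, hpD, hp⟩ := hp
  have hq : q ≠ 0 := by
    rintro rfl
    have hbot : (⊥ : Ideal C).IsMaximal := by
      rw [← Ideal.span_zero, ← Set.singleton_zero, ← hM]
      infer_instance
    let := (Ring.isField_iff_maximal_bot.2 hbot).toField
    exact hDed inferInstance
  have h := isPrincipalPullback_comap M hM hq D p hpD hp
  exact ⟨h.isISPDomain hSP, h.ringKrullDim_eq_two hSP,
    fun hA => hDed (h.isDedekindDomain_of_isHLocal hSP hA)⟩
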